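/- Let $G$ be a group generated by a finite set $S$ (every element of $G$ is the value $w_G$ of a word $w\in S^*$) with decidable word problem, and let $A$ be a finite alphabet. A \emph{shift} is a subset of $A^G$ that is closed in the product topology ($A$ discrete) and invariant under the translations $x\mapsto gx$, $(gx)(h)=x(g^{-1}h)$, $g\in G$; a \emph{pattern} is a map $p:F\to A$ with $F\subseteq G$ finite; the \emph{language} $\mathcal L(X)$ of a shift $X$ is the set of patterns $p:F\to A$ such that $x|_F=p$ for some $x\in X$. For the purposes of computability a pattern $p:F\to A$ is represented by the maps $W\to A$, $w\mapsto p(w_G)$, where $W\subset S^*$ is a finite set of words with $\{w_G : w\in W\}=F$. A shift $X$ has \emph{strong computable type} if for every oracle $O\subseteq\mathbb N$ such that the complement of $\mathcal L(X)$ in the set of all patterns is computably enumerable relative to $O$, the language $\mathcal L(X)$ is computable relative to $O$. \textbf{Proposition.} Let $X\subseteq A^G$ be an infinite shift such that every shift $Y\subsetneq X$ is finite. Then $X$ has strong computable type. -/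

import Mathlib

namespace GShift

open SymbolicDynamics.FullShift (MulSubshift)

/-! ### Groups given by finitely many generators -/

section Groups

variable {G : Type*} [Group G] {k : ℕ}

/-- The element of `G` spelled by a word in the generators `gen 0, …, gen (k - 1)`. -/
def wordEval (gen : Fin k → G) (w : List (Fin k)) : G :=
  (w.map gen).prod

/-- Every element of `G` is spelled by a word in the generators. -/
def IsGenerating (gen : Fin k → G) : Prop :=
  ∀ g : G, ∃ w : List (Fin k), wordEval gen w = g

/-- The word problem `{w | w = 1 in G}` is decidable. -/
def DecidableWordProblem (gen : Fin k → G) : Prop :=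
  ComputablePred fun w : List (Fin k) => wordEval gen w = 1

end Groups

/-! ### Computability relative to an oracle `O ⊆ ℕ` -/

section Oracles

/-- The set of oracle functions consisting of the characteristic function of `O`. -/
noncomputable def oracle (O : Set ℕ) : Set (ℕ →. ℕ) :=
  open Classical in {fun n => Part.some (if n ∈ O then 1 else 0)}

/-- `I` is computably enumerable relative to `O`: an algorithm with oracle `O` runs forever and
lists exactly the elements of `I`. The algorithm may list nothing at some step (`none`), so that
the empty set is included. -/
def EnumerableIn {α : Type*} [Primcodable α] (O : Set ℕ) (I : Set α) : Prop :=
  ∃ f : ℕ → Option α, ComputableIn (oracle O) f ∧ ∀ a, a ∈ I ↔ ∃ n, f n = some a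

/-- `I` is computable (decidable) relative to `O`: its characteristic function is computed by an
algorithm with oracle `O`. -/
def DecidableIn {α : Type*} [Primcodable α] (O : Set ℕ) (I : Set α) : Prop :=
  open Classical in ComputableIn (oracle O) fun a => decide (a ∈ I)

end Oracles

/-! ### Patterns, languages and their codes -/

section Languages

variable {A G : Type*}

/-- A pattern is a map `F → A` on a finite set `F ⊆ G`. -/
abbrev Pattern (A G : Type*) : Type _ := Σ F : Finset G, (F → A)

/-- The language of `X`: the patterns `p : F → A` with `x|_F = p` for some `x ∈ X`. -/
def language (X : Set (G → A)) : Set (Pattern A G) :=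
  {p | ∃ x ∈ X, ∀ i : p.1, x i = p.2 i}

/-- A finite set of pairs (word in the generators, letter), given as a list; generators and letters
are given by their numbers. -/
abbrev PatternCode (k m : ℕ) : Type := List (List (Fin k) × Fin m)

variable [Group G] {k m : ℕ}

/-- `c` is the graph of the function `w ↦ p(w_G)` on a finite set `W` of words whose values in `G`
are exactly the elements of the domain of `p`. -/
def Represents (gen : Fin k → G) (letter : Fin m ≃ A) (c : PatternCode k m)
    (p : Pattern A G) : Prop :=
  (∀ e ∈ c, ∃ h : wordEval gen e.1 ∈ p.1, p.2 ⟨wordEval gen e.1, h⟩ = letter e.2) ∧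
    ∀ i ∈ p.1, ∃ e ∈ c, wordEval gen e.1 = i

/-- The codes of the patterns in the set `L`. -/
def codes (gen : Fin k → G) (letter : Fin m ≃ A) (L : Set (Pattern A G)) :
    Set (PatternCode k m) :=
  {c | ∃ p ∈ L, Represents gen letter c p}

end Languages

/-! ### Shifts

A `G`-shift is a subset of `A ^ G` that is closed in the product topology (`A` discrete) and
invariant under the translations `x ↦ (h ↦ x (g * h))`, `g ∈ G`; as `G` is a group, this is the
same as invariance under `x ↦ (h ↦ x (g⁻¹ * h))`, `g ∈ G`. -/

section Shifts

variable {A G : Type*} [TopologicalSpace A] [Group G] {k m : ℕ}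

/-- `X` is effectively closed relative to `O`: the complement of its language (in the set of all
patterns) is computably enumerable relative to `O`. -/
def EffectivelyClosedIn (gen : Fin k → G) (letter : Fin m ≃ A) (O : Set ℕ)
    (X : MulSubshift A G) : Prop :=
  EnumerableIn O (codes gen letter (language X.carrier)ᶜ)

/-- The language of `X` is computable relative to `O`. -/
def ComputableLanguageIn (gen : Fin k → G) (letter : Fin m ≃ A) (O : Set ℕ)
    (X : MulSubshift A G) : Prop :=
  DecidableIn O (codes gen letter (language X.carrier))

/-- `X` has strong computable type: relative to every oracle relative to which `X` is effectively
closed, the language of `X` is computable. -/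
def StrongComputableType (gen : Fin k → G) (letter : Fin m ≃ A) (X : MulSubshift A G) : Prop :=
  ∀ O : Set ℕ, EffectivelyClosedIn gen letter O X → ComputableLanguageIn gen letter O X

/-- `X` is infinite, and all its proper subshifts are finite. -/
def InfiniteMinimal (X : MulSubshift A G) : Prop :=
  X.carrier.Infinite ∧ ∀ Y : MulSubshift A G, Y.carrier ⊂ X.carrier → Y.carrier.Finite

end Shifts

end GShift

/-! ### Computability relative to a set of oracle functions -/

namespace ComputableIn

open Encodable

variable {α β γ : Type*} [Primcodable α] [Primcodable β] [Primcodable γ] {O : Set (ℕ →. ℕ)}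

/-! Membership in the language of `X` is shown to be semi-decidable relative to `O` on both sides;
waiting for the first verdict then decides it.

A code `c` is matched by a point of `X` exactly when the subshift of points in which no translate of
`c` occurs is finite: if `c` occurs, this subshift is proper, hence finite; if not, it is all of the
infinite shift `X` (`InfiniteMinimal.finite_avoiding`, `DeterminedCert.exists_matches`).

Finiteness is witnessed by a finite set `D` of words containing the empty word such that points
agreeing on `D` agree on all `s :: d` with `d ∈ D`. By shift invariance such agreement spreads to
the whole group, so restriction to `D` is injective (`finite_of_propagates`). Conversely, a finite
shift has a finite separating set, for which propagation is trivial. Compactness makes this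
propagation visible at a finite stage: each pair of partial assignments violates a constraint listed
so far, differs on `D`, or agrees on the successors (`Exhausts.determinedCert`).

Configurations are handled as assignments of letters to words. The decidable word problem allows
listing the pairs that give distinct letters to one group element. These pairs confine the
assignments to genuine configurations, and they also expose codes that represent no pattern
(`Exhausts.excludedCert`). -/

theorem comp {f : β → γ} {g : α → β} (hf : ComputableIn O f) (hg : ComputableIn O g) :
    ComputableIn O fun a => f (g a) := by
  refine (Nat.RecursiveIn.comp hf hg).of_eq fun n => ?_
  cases h : (decode n : Option α) <;> simp

theorem pair {f : α → β} {g : α → γ} (hf : ComputableIn O f) (hg : ComputableIn O g) :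
    ComputableIn O fun a => (f a, g a) := by
  refine (Nat.RecursiveIn.pair hf hg).of_eq fun n => ?_
  cases h : (decode n : Option α) <;> simp [Seq.seq]

/-- Finite histories of a function are computable in the oracles that compute the function. -/
theorem history {f : ℕ → β} (hf : ComputableIn O f) :
    ComputableIn O fun n => (List.range n).map f := by
  have hstep : ComputableIn O fun p : ℕ × ℕ × List β => p.2.2 ++ [f p.2.1] :=
    (Primrec.list_concat (α := β)).to_comp.computableIn.comp
      ((ComputableIn.snd.comp ComputableIn.snd).pair
        (hf.comp (ComputableIn.fst.comp ComputableIn.snd)))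
  have hbase : ComputableIn O fun _ : ℕ => ([] : List β) := ComputableIn.const _
  -- `prec` expects a parameter paired with the recursion depth; the parameter `0` is a dummy.
  have hin : Nat.RecursiveIn O fun n => Part.some (Nat.pair 0 n) :=
    Nat.Primrec.recursiveIn (Nat.Primrec.pair (Nat.Primrec.const 0) Nat.Primrec.id)
  refine (Nat.RecursiveIn.comp (Nat.RecursiveIn.prec hbase hstep) hin).of_eq fun n => ?_
  have key : ∀ n : ℕ, (Nat.rec (Part.some (encode ([] : List β)))
      (fun y IH => IH.bind fun i => (Part.ofOption
        (decode (α := ℕ × ℕ × List β) (Nat.pair 0 (Nat.pair y i)))).bind fun p =>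
          (Part.some (p.2.2 ++ [f p.2.1])).map encode) n : Part ℕ) =
      Part.some (encode ((List.range n).map f)) := by
    intro n
    induction n with
    | zero => rfl
    | succ n ih =>
      refine (congrArg (Part.bind · _) ih).trans ?_
      simp [List.range_succ]
  simpa using key n

/-- Unbounded search for a predicate that is always satisfied somewhere. -/
theorem exists_search {p : α → ℕ → Bool} (hp : ComputableIn O fun q : α × ℕ => p q.1 q.2)
    (h : ∀ a, ∃ n, p a n = true) :
    ∃ s : α → ℕ, ComputableIn O s ∧ ∀ a, p a (s a) = true := by
  have h' : ∀ a, ∃ n, p a n = true ∧ ∀ k < n, p a k = false := fun a => by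
    classical
    exact ⟨Nat.find (h a), Nat.find_spec (h a), fun k hk => by simpa using Nat.find_min (h a) hk⟩
  choose s hs hmin using h'
  refine ⟨s, ?_, hs⟩
  -- `rfind` searches for a zero, so `true` is turned into `0`.
  have hc : ComputableIn O fun q : α × ℕ => if p q.1 q.2 then 0 else 1 :=
    ComputableIn.comp (f := fun b : Bool => if b then 0 else 1)
      (Primrec.dom_finite _).computableIn hp
  refine (Nat.RecursiveIn.rfind hc).of_eq fun n => ?_
  cases hd : (decode n : Option α) with
  | none =>
    simp only [Part.coe_none, Part.bind_none]
    -- On a number that codes no element of `α` no trial value is defined, so the search diverges,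
    -- as required.
    refine Part.eq_none_iff'.2 fun hdom => ?_
    have := (Nat.mem_rfind.1 (Part.get_mem hdom)).1
    simp [hd] at this
  | some a =>
    refine (Part.eq_some_iff.2 (Nat.mem_rfind.2 ⟨?_, fun {k} hk => ?_⟩) : _ = Part.some (s a)).trans
      (by simp)
    · simp [hd, hs]
    · simp [hd, hmin a k hk]

/-- A predicate is decidable relative to `O` if a computable test that is given longer and longer
histories of a function `f` computable in `O` always reaches the right verdict. -/
theorem of_history {f : ℕ → β} (hf : ComputableIn O f) {R : α → List β → Option Bool}
    (hR : Computable₂ R) {v : α → Bool}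
    (sound : ∀ a n b, R a ((List.range n).map f) = some b → v a = b)
    (complete : ∀ a, ∃ n, (R a ((List.range n).map f)).isSome) : ComputableIn O v := by
  have hR' : ComputableIn O fun q : α × ℕ => R q.1 ((List.range q.2).map f) :=
    (Computable.computableIn hR).comp (ComputableIn.fst.pair (hf.history.comp ComputableIn.snd))
  obtain ⟨s, hs, hs'⟩ := exists_search (Primrec.option_isSome.computableIn.comp hR') complete
  have : ComputableIn O fun a => (R a ((List.range (s a)).map f)).getD false :=
    ComputableIn.comp (f := fun o : Option Bool => o.getD false) (Primrec.dom_finite _).computableIn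
      (hR'.comp (ComputableIn.id.pair hs))
  convert this using 2 with a
  obtain ⟨b, hb⟩ := Option.isSome_iff_exists.1 (hs' a)
  rw [hb, sound a _ b hb, Option.getD_some]

end ComputableIn

namespace GShift

open SymbolicDynamics.FullShift (MulSubshift mulShift)
open Encodable

/-! ### Configurations that match a pattern code -/

section Codes

variable {A G : Type*} [Group G] {k m : ℕ} {gen : Fin k → G} {letter : Fin m ≃ A}

@[simp]
theorem wordEval_nil : wordEval gen [] = 1 := rfl

@[simp]
theorem wordEval_cons (s : Fin k) (w : List (Fin k)) :
    wordEval gen (s :: w) = gen s * wordEval gen w := by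
  simp [wordEval]

@[simp]
theorem wordEval_append (u v : List (Fin k)) :
    wordEval gen (u ++ v) = wordEval gen u * wordEval gen v := by
  simp [wordEval]

/-- The configuration `x` has the letters that the code `c` prescribes. -/
def Matches (gen : Fin k → G) (letter : Fin m ≃ A) (x : G → A) (c : PatternCode k m) : Prop :=
  ∀ e ∈ c, x (wordEval gen e.1) = letter e.2

/-- The restriction of a configuration to a finite set. -/
def restriction (x : G → A) (F : Finset G) : Pattern A G := ⟨F, fun i => x i⟩

open Classical in
/-- A configuration that matches a code also extends the pattern on the words of the code. -/
theorem Matches.represents {x : G → A} {c : PatternCode k m} (h : Matches gen letter x c) :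
    Represents gen letter c (restriction x (c.map fun e => wordEval gen e.1).toFinset) := by
  refine ⟨fun e he => ⟨?_, h e he⟩, fun i hi => ?_⟩
  · simp only [restriction, List.mem_toFinset, List.mem_map]
    exact ⟨e, he, rfl⟩
  · simpa [restriction] using hi

theorem Represents.matches_iff {p : Pattern A G} {c : PatternCode k m}
    (h : Represents gen letter c p) (x : G → A) :
    Matches gen letter x c ↔ ∀ i : p.1, x i = p.2 i := by
  constructor
  · rintro hx ⟨i, hi⟩
    obtain ⟨e, he, rfl⟩ := h.2 i hi
    obtain ⟨_, h2⟩ := h.1 e he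
    rw [hx e he, ← h2]
  · intro hx e he
    obtain ⟨h1, h2⟩ := h.1 e he
    rw [← h2, ← hx]

/-- This removes patterns from the argument: from here on, occurrence of a code means being matched
by a point. -/
theorem mem_codes_language {X : Set (G → A)} {c : PatternCode k m} :
    c ∈ codes gen letter (language X) ↔ ∃ x ∈ X, Matches gen letter x c := by
  constructor
  · rintro ⟨p, ⟨x, hx, hxp⟩, hp⟩
    exact ⟨x, hx, (hp.matches_iff x).2 hxp⟩
  · rintro ⟨x, hx, hxc⟩
    exact ⟨_, ⟨x, hx, fun _ => rfl⟩, hxc.represents⟩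

theorem not_matches_of_mem_codes {X : Set (G → A)} {c : PatternCode k m}
    (hc : c ∈ codes gen letter (language X)ᶜ) {x : G → A} (hx : x ∈ X) :
    ¬ Matches gen letter x c := by
  obtain ⟨p, hp, hcp⟩ := hc
  exact fun h => hp ⟨x, hx, (hcp.matches_iff x).1 h⟩

/-- The configuration `x`, which need not lie in `X`, guarantees that `c` represents some pattern.
An inconsistent code represents none and is a code neither for the language nor for its complement.
-/
theorem Matches.mem_codes_compl {X : Set (G → A)} {c : PatternCode k m} {x : G → A}
    (hx : Matches gen letter x c) (hc : c ∉ codes gen letter (language X)) :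
    c ∈ codes gen letter (language X)ᶜ :=
  ⟨_, fun h => hc ⟨_, h, hx.represents⟩, hx.represents⟩

/-- A code that gives equal letters to equal elements is matched by some configuration. -/
theorem exists_matches [Nonempty A] {c : PatternCode k m}
    (hc : ∀ e ∈ c, ∀ e' ∈ c, wordEval gen e.1 = wordEval gen e'.1 → e.2 = e'.2) :
    ∃ x : G → A, Matches gen letter x c := by
  classical
  refine ⟨fun g => if h : ∃ e ∈ c, wordEval gen e.1 = g then letter h.choose.2
    else Classical.arbitrary A, fun e he => ?_⟩
  have h : ∃ e' ∈ c, wordEval gen e'.1 = wordEval gen e.1 := ⟨e, he, rfl⟩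
  simp only [dif_pos h]
  rw [hc _ h.choose_spec.1 e he h.choose_spec.2]

/-- A configuration outside a shift matches the code of a pattern outside its language. -/
theorem exists_code_of_notMem [TopologicalSpace A] [DiscreteTopology A] (hgen : IsGenerating gen)
    {X : Set (G → A)} (hX : IsClosed X) {x : G → A} (hx : x ∉ X) :
    ∃ c ∈ codes gen letter (language X)ᶜ, Matches gen letter x c := by
  classical
  obtain ⟨F, u, hu, hsub⟩ := isOpen_pi_iff.1 hX.isOpen_compl x hx
  choose w hw using hgen
  let c : PatternCode k m := F.toList.map fun g => (w g, letter.symm (x g))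
  have hc : Matches gen letter x c := by
    intro e he
    obtain ⟨g, -, rfl⟩ := List.mem_map.1 he
    simp [hw]
  refine ⟨c, hc.mem_codes_compl fun h => ?_, hc⟩
  obtain ⟨y, hy, hyc⟩ := mem_codes_language.1 h
  refine hsub (fun g hg => ?_) hy
  have := hyc (w g, letter.symm (x g)) (List.mem_map.2 ⟨g, by simpa using hg, rfl⟩)
  simp only [hw, Equiv.apply_symm_apply] at this
  rw [this]
  exact (hu g hg).2

/-- The code of a translated pattern. -/
def translate (c : PatternCode k m) (t : List (Fin k)) : PatternCode k m :=
  c.map fun e => (t ++ e.1, e.2)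

theorem matches_translate {x : G → A} {c : PatternCode k m} {t : List (Fin k)} :
    Matches gen letter x (translate c t) ↔
      Matches gen letter (mulShift (wordEval gen t) x) c := by
  simp only [Matches, translate, List.forall_mem_map, wordEval_append, mulShift]

/-- The points of a shift in which the coded pattern does not occur form a shift. -/
def avoiding [TopologicalSpace A] [DiscreteTopology A] (gen : Fin k → G) (letter : Fin m ≃ A)
    (X : MulSubshift A G) (c : PatternCode k m) : MulSubshift A G where
  carrier := {x ∈ X.carrier | ∀ g, ¬ Matches gen letter (mulShift g x) c}
  isClosed := by
    have hcl : ∀ g : G, IsOpen {x : G → A | Matches gen letter (mulShift g x) c} := fun g => by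
      have : {x : G → A | Matches gen letter (mulShift g x) c} =
          ⋂ e ∈ {e | e ∈ c}, (fun x : G → A => x (g * wordEval gen e.1)) ⁻¹' {letter e.2} := by
        ext x
        simp [Matches]
      rw [this]
      exact c.finite_toSet.isOpen_biInter fun e _ =>
        (isOpen_discrete _).preimage (continuous_apply _)
    have : {x ∈ X.carrier | ∀ g, ¬ Matches gen letter (mulShift g x) c} =
        X.carrier ∩ ⋂ g : G, {x | Matches gen letter (mulShift g x) c}ᶜ := by
      ext x
      simp
    rw [this]
    exact X.isClosed.inter (isClosed_iInter fun g => (hcl g).isClosed_compl)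
  mapsTo g x hx := ⟨X.mapsTo g hx.1, fun g' h => hx.2 (g * g') (by
    simpa [Matches, mulShift, mul_assoc] using h)⟩

end Codes

/-! ### Finite certificates -/

section Certificates

variable {k m : ℕ}

/-- The list `l` of letters, indexed by the numbers of words, has the letters that `c` prescribes. -/
def ListMatches (l : List (Fin m)) (c : PatternCode k m) : Prop :=
  ∀ e ∈ c, l[encode e.1]? = some e.2

/-- The products of a generator and a word in `D`. -/
def successors (D : List (List (Fin k))) : List (List (Fin k)) :=
  D.flatMap fun d => (List.finRange k).map fun s => s :: d

/-- The partial assignments `x` and `y` visibly violate one of the following constraints: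
no code in `Φ` is matched, `x` and `y` agree on `D`, and they differ on a successor of `D`. -/
def Refuted (Φ : List (PatternCode k m)) (D : List (List (Fin k))) (x y : List (Fin m)) : Prop :=
  (∃ c ∈ Φ, ListMatches x c ∨ ListMatches y c) ∨ (∃ d ∈ D, x[encode d]? ≠ y[encode d]?) ∨
    ∀ d ∈ successors D, encode d < x.length ∧ x[encode d]? = y[encode d]?

/-- The words with numbers less than `N`. -/
def wordsBelow (k N : ℕ) : List (List (Fin k)) :=
  (List.range N).flatMap fun i => (decode i : Option (List (Fin k))).toList

/-- All lists of length `N` over `Fin m`. -/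
def allLists (m : ℕ) : ℕ → List (List (Fin m))
  | 0 => [[]]
  | N + 1 => (allLists m N).flatMap fun l => (List.finRange m).map fun a => a :: l

/-- A finite certificate that the points that avoid `Λ` and the translates of `c` are determined by
their values on `D`. -/
def DeterminedCert (c : PatternCode k m) (Λ : List (PatternCode k m)) (D : List (List (Fin k)))
    (N : ℕ) : Prop :=
  ∀ x ∈ allLists m N, ∀ y ∈ allLists m N,
    Refuted (Λ ++ (wordsBelow k N).map (translate c)) D x y

/-- A finite certificate that no point that avoids `Λ` matches `c`. -/
def ExcludedCert (c : PatternCode k m) (Λ : List (PatternCode k m)) : Prop :=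
  c ∈ Λ ∨ ∃ e ∈ c, ∃ e' ∈ c, [e, e'] ∈ Λ

theorem mem_allLists {N : ℕ} {l : List (Fin m)} : l ∈ allLists m N ↔ l.length = N := by
  induction N generalizing l with
  | zero => simp [allLists]
  | succ N ih =>
    cases l with
    | nil => simp [allLists]
    | cons a l => simp [allLists, ih]

theorem mem_wordsBelow {N : ℕ} {w : List (Fin k)} (hw : encode w < N) : w ∈ wordsBelow k N := by
  simp only [wordsBelow, List.mem_flatMap, List.mem_range, Option.mem_toList]
  exact ⟨_, hw, encodek w⟩

theorem wordsBelow_subset {M N : ℕ} (h : M ≤ N) : wordsBelow k M ⊆ wordsBelow k N := by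
  intro w hw
  simp only [wordsBelow, List.mem_flatMap, List.mem_range] at hw ⊢
  obtain ⟨i, hi, hw⟩ := hw
  exact ⟨i, hi.trans_le h, hw⟩

theorem ListMatches.iff_ofFn {x : ℕ → Fin m} {N : ℕ} {c : PatternCode k m} :
    ListMatches (List.ofFn fun i : Fin N => x i) c ↔
      ∀ e ∈ c, encode e.1 < N ∧ x (encode e.1) = e.2 := by
  simp [ListMatches, List.getElem?_ofFn]

/-- Every violation is witnessed by finitely many letters and at most one constraint, so it persists
under longer assignments and more constraints. -/
theorem Refuted.mono {Φ Ψ : List (PatternCode k m)} {D : List (List (Fin k))} {x y : ℕ → Fin m}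
    {M N : ℕ} (hMN : M ≤ N) (hΦ : Φ ⊆ Ψ)
    (h : Refuted Φ D (List.ofFn fun i : Fin M => x i) (List.ofFn fun i : Fin M => y i)) :
    Refuted Ψ D (List.ofFn fun i : Fin N => x i) (List.ofFn fun i : Fin N => y i) := by
  simp only [Refuted, ListMatches.iff_ofFn, List.getElem?_ofFn, List.length_ofFn] at h ⊢
  rcases h with ⟨c, hc, h⟩ | ⟨d, hd, h⟩ | h
  · exact Or.inl ⟨c, hΦ hc, h.imp (fun h e he => ⟨(h e he).1.trans_le hMN, (h e he).2⟩)
      fun h e he => ⟨(h e he).1.trans_le hMN, (h e he).2⟩⟩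
  · refine Or.inr (Or.inl ⟨d, hd, ?_⟩)
    by_cases hdM : encode d < M
    · simpa [hdM, hdM.trans_le hMN] using h
    -- Beyond the end of both lists the lookups are both `none`, so they cannot differ.
    · simp [hdM] at h
  · refine Or.inr (Or.inr fun d hd => ?_)
    obtain ⟨h1, h2⟩ := h d hd
    exact ⟨h1.trans_le hMN, by simpa [h1, h1.trans_le hMN] using h2⟩

end Certificates

/-! ### Soundness and completeness of the certificates -/

section Correctness

variable {A G : Type*} [Group G] {k m : ℕ} {gen : Fin k → G}
  {letter : Fin m ≃ A}

/-- If the points of a shift are determined by their values on `D`, where `D` is nonempty and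
agreement on `D` propagates to the successors of `D`, then the shift is finite. -/
theorem finite_of_propagates [TopologicalSpace A] (hgen : IsGenerating gen) (letter : Fin m ≃ A) (X : MulSubshift A G)
    {D : List (List (Fin k))} (hD : [] ∈ D)
    (hprop : ∀ x ∈ X.carrier, ∀ y ∈ X.carrier,
      (∀ d ∈ D, x (wordEval gen d) = y (wordEval gen d)) →
        ∀ d ∈ successors D, x (wordEval gen d) = y (wordEval gen d)) :
    X.carrier.Finite := by
  have : Finite A := Finite.of_equiv _ letter
  have key : ∀ w : List (Fin k), ∀ x ∈ X.carrier, ∀ y ∈ X.carrier,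
      (∀ d ∈ D, x (wordEval gen d) = y (wordEval gen d)) →
        x (wordEval gen w) = y (wordEval gen w) := by
    intro w
    induction w with
    | nil => exact fun x _ y _ h => h [] hD
    | cons s w ih =>
      intro x hx y hy h
      -- The translates by `gen s` agree on `D` because `x` and `y` agree on the words `s :: d`; the
      -- induction hypothesis applies to these translates.
      have := ih _ (X.mapsTo (gen s) hx) _ (X.mapsTo (gen s) hy) fun d hd => by
        have := hprop x hx y hy h (s :: d)
          (List.mem_flatMap.2 ⟨d, hd, List.mem_map.2 ⟨s, List.mem_finRange s, rfl⟩⟩)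
        simpa [mulShift] using this
      simpa [mulShift] using this
  refine Set.Finite.of_injOn (f := fun x : G → A => fun d : {d // d ∈ D} => x (wordEval gen d))
    (t := Set.univ) (fun _ _ => trivial) (fun x hx y hy hxy => ?_) Set.finite_univ
  funext g
  obtain ⟨w, rfl⟩ := hgen g
  exact key w x hx y hy fun d hd => congrFun hxy ⟨d, hd⟩

/-- The letters of a configuration, indexed by the numbers of words. -/
def wordLetters (gen : Fin k → G) (letter : Fin m ≃ A) (x : G → A) (i : ℕ) : Fin m :=
  letter.symm (x (wordEval gen ((decode i : Option (List (Fin k))).getD [])))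

@[simp]
theorem wordLetters_encode (x : G → A) (w : List (Fin k)) :
    wordLetters gen letter x (encode w) = letter.symm (x (wordEval gen w)) := by
  simp [wordLetters]

theorem Matches.of_listMatches {x : G → A} {c : PatternCode k m} {N : ℕ}
    (h : ListMatches (List.ofFn fun i : Fin N => wordLetters gen letter x i) c) :
    Matches gen letter x c := by
  intro e he
  have := (ListMatches.iff_ofFn.1 h e he).2
  rw [wordLetters_encode] at this
  exact (letter.symm_apply_eq).1 this

/-- Soundness of a positive verdict: if no point of `X` matched `c`, all points would satisfy the
constraints, so the certificate would give propagation on `X` itself and make `X` finite. -/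
theorem DeterminedCert.exists_matches [TopologicalSpace A] (hgen : IsGenerating gen) {X : MulSubshift A G}
    (hX : X.carrier.Infinite) {c : PatternCode k m} {Λ : List (PatternCode k m)}
    (hΛ : ∀ c' ∈ Λ, ∀ x ∈ X.carrier, ¬ Matches gen letter x c') {D : List (List (Fin k))}
    (hD : [] ∈ D) {N : ℕ} (h : DeterminedCert c Λ D N) :
    ∃ x ∈ X.carrier, Matches gen letter x c := by
  by_contra! hc
  refine hX (finite_of_propagates hgen letter X hD fun x hx y hy hxy d hd => ?_)
  have hΦ : ∀ c' ∈ Λ ++ (wordsBelow k N).map (translate c), ∀ x ∈ X.carrier,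
      ¬ ListMatches (List.ofFn fun i : Fin N => wordLetters gen letter x i) c' := by
    intro c' hc' x hx hl
    rcases List.mem_append.1 hc' with hc' | hc'
    · exact hΛ c' hc' x hx (.of_listMatches hl)
    · obtain ⟨t, -, rfl⟩ := List.mem_map.1 hc'
      exact hc _ (X.mapsTo _ hx) (matches_translate.1 (.of_listMatches hl))
  rcases h (List.ofFn fun i : Fin N => wordLetters gen letter x i) (mem_allLists.2 (by simp))
      (List.ofFn fun i : Fin N => wordLetters gen letter y i) (mem_allLists.2 (by simp)) with
    ⟨c', hc', h | h⟩ | ⟨d', hd', h⟩ | h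
  · exact (hΦ c' hc' x hx h).elim
  · exact (hΦ c' hc' y hy h).elim
  · simp [List.getElem?_ofFn, hxy d' hd'] at h
  · obtain ⟨h1, h2⟩ := h d hd
    rw [List.length_ofFn] at h1
    simpa [List.getElem?_ofFn, h1] using h2

theorem ExcludedCert.not_matches {X : Set (G → A)} {c : PatternCode k m}
    {Λ : List (PatternCode k m)} (hΛ : ∀ c' ∈ Λ, ∀ x ∈ X, ¬ Matches gen letter x c')
    (h : ExcludedCert c Λ) : ∀ x ∈ X, ¬ Matches gen letter x c := by
  rintro x hx hxc
  rcases h with h | ⟨e, he, e', he', h⟩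
  · exact hΛ c h x hx hxc
  · refine hΛ _ h x hx fun f hf => hxc f ?_
    rcases List.mem_pair.1 hf with rfl | rfl <;> assumption

/-- Finitely many points are separated by their values on finitely many words. -/
theorem exists_separating (hgen : IsGenerating gen) {S : Set (G → A)} (hS : S.Finite) :
    ∃ D : List (List (Fin k)), ∀ x ∈ S, ∀ y ∈ S,
      (∀ d ∈ D, x (wordEval gen d) = y (wordEval gen d)) → x = y := by
  classical
  have hsep : ∀ p : (G → A) × (G → A), ∃ w : List (Fin k),
      p.1 (wordEval gen w) = p.2 (wordEval gen w) → p.1 = p.2 := by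
    intro p
    by_cases h : p.1 = p.2
    · exact ⟨[], fun _ => h⟩
    · obtain ⟨g, hg⟩ := Function.ne_iff.1 h
      obtain ⟨w, rfl⟩ := hgen g
      exact ⟨w, fun h => (hg h).elim⟩
  choose w hw using hsep
  refine ⟨((hS.prod hS).toFinset.image w).toList, fun x hx y hy h => hw (x, y) (h _ ?_)⟩
  simp only [Finset.mem_toList, Finset.mem_image, Set.Finite.mem_toFinset]
  exact ⟨(x, y), ⟨hx, hy⟩, rfl⟩

/-- An increasing sequence of lists of codes exhausts the codes of the forbidden patterns of `X` and
the two-element codes that give different letters to the same element. -/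
structure Exhausts [TopologicalSpace A] (gen : Fin k → G) (letter : Fin m ≃ A)
    (X : MulSubshift A G) (Λ : ℕ → List (PatternCode k m)) : Prop where
  mono : ∀ {M N}, M ≤ N → Λ M ⊆ Λ N
  not_matches : ∀ n, ∀ c ∈ Λ n, ∀ x ∈ X.carrier, ¬ Matches gen letter x c
  forbidden : ∀ c ∈ codes gen letter (language X.carrier)ᶜ, ∃ n, c ∈ Λ n
  inconsistent : ∀ e e' : List (Fin k) × Fin m, wordEval gen e.1 = wordEval gen e'.1 →
    e.2 ≠ e'.2 → ∃ n, [e, e'] ∈ Λ n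

variable [TopologicalSpace A] {X : MulSubshift A G} {Λ : ℕ → List (PatternCode k m)}

/-- A consistent code extends to a configuration, so it codes a forbidden pattern and is eventually
listed. An inconsistent code may never be listed, but it contains an inconsistent pair that is. -/
theorem Exhausts.excludedCert [Nonempty A] (hΛ : Exhausts gen letter X Λ) {c : PatternCode k m}
    (hc : c ∉ codes gen letter (language X.carrier)) :
    ∃ n, ExcludedCert c (Λ n) := by
  by_cases hcons : ∀ e ∈ c, ∀ e' ∈ c, wordEval gen e.1 = wordEval gen e'.1 → e.2 = e'.2
  · obtain ⟨x, hx⟩ := GShift.exists_matches (letter := letter) hcons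
    exact (hΛ.forbidden c (hx.mem_codes_compl hc)).imp fun n hn => Or.inl hn
  · push Not at hcons
    obtain ⟨e, he, e', he', h1, h2⟩ := hcons
    exact (hΛ.inconsistent e e' h1 h2).imp fun n hn => Or.inr ⟨e, he, e', he', hn⟩

/-- An assignment of letters to words that is never refuted comes from a point of `X`. -/
theorem Exhausts.exists_point [DiscreteTopology A] (hgen : IsGenerating gen)
    (hΛ : Exhausts gen letter X Λ)
    {x : ℕ → Fin m} (hx : ∀ n, ∀ c ∈ Λ n, ¬ ∀ e ∈ c, x (encode e.1) = e.2) :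
    ∃ z ∈ X.carrier, ∀ w, z (wordEval gen w) = letter (x (encode w)) := by
  -- Avoiding the inconsistent pairs makes the assignment descend from words to group elements.
  have heq : ∀ u v, wordEval gen u = wordEval gen v → x (encode u) = x (encode v) := by
    intro u v huv
    by_contra hne
    obtain ⟨n, hn⟩ := hΛ.inconsistent (u, x (encode u)) (v, x (encode v)) huv hne
    exact hx n _ hn (by simp)
  choose w hw using hgen
  have hz : ∀ u, letter (x (encode (w (wordEval gen u)))) = letter (x (encode u)) := fun u =>
    congrArg letter (heq _ _ (hw _))
  refine ⟨fun g => letter (x (encode (w g))), ?_, hz⟩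
  by_contra hmem
  obtain ⟨c, hc, hcm⟩ := exists_code_of_notMem (fun g => ⟨w g, hw g⟩) X.isClosed
    (letter := letter) hmem
  obtain ⟨n, hn⟩ := hΛ.forbidden c hc
  exact hx n c hn fun e he => letter.injective ((hz e.1).symm.trans (hcm e he))

/-- The constraints become visibly violated on every assignment. -/
theorem Exhausts.exists_refuted [DiscreteTopology A] (hgen : IsGenerating gen)
    (hΛ : Exhausts gen letter X Λ) {c : PatternCode k m} {D : List (List (Fin k))}
    (hD : ∀ x ∈ (avoiding gen letter X c).carrier, ∀ y ∈ (avoiding gen letter X c).carrier,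
      (∀ d ∈ D, x (wordEval gen d) = y (wordEval gen d)) → x = y)
    (x y : ℕ → Fin m) :
    ∃ N, Refuted (Λ N ++ (wordsBelow k N).map (translate c)) D
      (List.ofFn fun i : Fin N => x i) (List.ofFn fun i : Fin N => y i) := by
  -- Assignments that are never refuted come from points of the avoiding shift that agree on `D`.
  -- These points are equal, so they agree on the successors of `D`, which is itself a refutation
  -- once `N` exceeds the numbers of all successors.
  by_contra! h
  have hbound : ∀ l : List (List (Fin k)), ∃ N, ∀ w ∈ l, encode w < N := by
    intro l
    obtain ⟨N, hN⟩ := ((l.map encode).toFinset : Finset ℕ).bddAbove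
    exact ⟨N + 1, fun w hw => Nat.lt_succ_of_le
      (hN (Finset.mem_coe.2 (List.mem_toFinset.2 (List.mem_map_of_mem hw))))⟩
  have hcode : ∀ n, ∀ c' ∈ Λ n ++ (wordsBelow k n).map (translate c),
      (¬ ∀ e ∈ c', x (encode e.1) = e.2) ∧ ¬ ∀ e ∈ c', y (encode e.1) = e.2 := by
    intro n c' hc'
    -- The stage `max n N` both lists `c'` and is long enough to show the letters at all its words.
    obtain ⟨N, hN⟩ := hbound (c'.map Prod.fst)
    have hmem : c' ∈ Λ (max n N) ++ (wordsBelow k (max n N)).map (translate c) := by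
      rcases List.mem_append.1 hc' with h | h
      · exact List.mem_append_left _ (hΛ.mono (le_max_left _ _) h)
      · refine List.mem_append_right _ (List.map_subset _ (wordsBelow_subset (le_max_left _ _)) h)
    have hlt : ∀ e ∈ c', encode e.1 < max n N := fun e he =>
      (hN _ (List.mem_map_of_mem he)).trans_le (le_max_right _ _)
    refine ⟨fun hm => h _ (Or.inl ⟨c', hmem, Or.inl ?_⟩),
      fun hm => h _ (Or.inl ⟨c', hmem, Or.inr ?_⟩)⟩ <;>
    exact ListMatches.iff_ofFn.2 fun e he => ⟨hlt e he, hm e he⟩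
  obtain ⟨x', hx', hx⟩ := hΛ.exists_point hgen (x := x)
    fun n c' hc' => (hcode n c' (List.mem_append_left _ hc')).1
  obtain ⟨y', hy', hy⟩ := hΛ.exists_point hgen (x := y)
    fun n c' hc' => (hcode n c' (List.mem_append_left _ hc')).2
  have htrans : ∀ t, translate c t ∈ Λ (encode t + 1) ++
      (wordsBelow k (encode t + 1)).map (translate c) := fun t =>
    List.mem_append_right _ (List.mem_map_of_mem (mem_wordsBelow (Nat.lt_succ_self _)))
  have hxc : x' ∈ (avoiding gen letter X c).carrier := by
    refine ⟨hx', fun g hg => ?_⟩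
    obtain ⟨t, rfl⟩ := hgen g
    exact (hcode _ _ (htrans t)).1 fun e he => letter.injective
      ((hx e.1).symm.trans (matches_translate.2 hg e he))
  have hyc : y' ∈ (avoiding gen letter X c).carrier := by
    refine ⟨hy', fun g hg => ?_⟩
    obtain ⟨t, rfl⟩ := hgen g
    exact (hcode _ _ (htrans t)).2 fun e he => letter.injective
      ((hy e.1).symm.trans (matches_translate.2 hg e he))
  have hagree : x' = y' := by
    refine hD x' hxc y' hyc fun d hd => ?_
    by_contra hne
    rw [hx, hy] at hne
    refine h (encode d + 1) (Or.inr (Or.inl ⟨d, hd, fun heq => hne ?_⟩))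
    simp only [List.getElem?_ofFn, Nat.lt_succ_self, dif_pos, Option.some.injEq] at heq
    rw [heq]
  obtain ⟨N, hN⟩ := hbound (successors D)
  refine h N (Or.inr (Or.inr fun d hd => ⟨by simpa using hN d hd, ?_⟩))
  have := hx d
  rw [hagree, hy] at this
  simp [List.getElem?_ofFn, letter.injective this]

/-- Completeness of the positive verdict, by compactness: the pairs refuted at stage `N` form an
increasing open cover of the compact space of pairs of assignments, so a single stage refutes all.
Validity at all later stages is needed because the stage number must also encode `D`. -/
theorem Exhausts.determinedCert [DiscreteTopology A] [Nonempty A] (hgen : IsGenerating gen)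
    (hΛ : Exhausts gen letter X Λ) {c : PatternCode k m}
    (hfin : (avoiding gen letter X c).carrier.Finite) :
    ∃ D N, ∀ M ≥ N, DeterminedCert c (Λ M) ([] :: D) M := by
  obtain ⟨D, hD⟩ := exists_separating hgen hfin
  have : Nonempty (Fin m) := ‹Nonempty A›.map letter.symm
  let U : ℕ → Set ((ℕ → Fin m) × (ℕ → Fin m)) := fun N =>
    {z | Refuted (Λ N ++ (wordsBelow k N).map (translate c)) ([] :: D)
      (List.ofFn fun i : Fin N => z.1 i) (List.ofFn fun i : Fin N => z.2 i)}
  have hU : Monotone U := by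
    intro M N hMN z hz
    refine Refuted.mono hMN (fun c' hc' => ?_) hz
    rcases List.mem_append.1 hc' with h | h
    · exact List.mem_append_left _ (hΛ.mono hMN h)
    · refine List.mem_append_right _ (List.map_subset _ (wordsBelow_subset hMN) h)
  have hopen : ∀ N, IsOpen (U N) := fun N => by
    have hcont : Continuous fun z : (ℕ → Fin m) × (ℕ → Fin m) =>
        ((fun i : Fin N => z.1 i), fun i : Fin N => z.2 i) := by fun_prop
    exact (isOpen_discrete {p : (Fin N → Fin m) × (Fin N → Fin m) |
      Refuted (Λ N ++ (wordsBelow k N).map (translate c)) ([] :: D)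
        (List.ofFn p.1) (List.ofFn p.2)}).preimage hcont
  obtain ⟨N, hN⟩ := isCompact_univ.elim_directed_cover U hopen
    (fun z _ => Set.mem_iUnion.2 (hΛ.exists_refuted hgen
      (fun x hx y hy h => hD x hx y hy fun d hd => h d (List.mem_cons_of_mem _ hd)) z.1 z.2))
    hU.directed_le
  refine ⟨D, N, fun M hM x hx y hy => ?_⟩
  have hext : ∀ l ∈ allLists m M, ∃ z : ℕ → Fin m, (List.ofFn fun i : Fin M => z i) = l := by
    intro l hl
    -- The padding letter is irrelevant: only the first `M` values are read.
    refine ⟨fun i => l.getD i (Classical.arbitrary _), List.ext_getElem ?_ fun i h1 h2 => ?_⟩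
    · simp [mem_allLists.1 hl]
    · simp [h2]
  obtain ⟨x, rfl⟩ := hext x hx
  obtain ⟨y, rfl⟩ := hext y hy
  exact hU hM (hN (Set.mem_univ (x, y)))

/-- In an infinite shift all of whose proper subshifts are finite, a coded pattern occurs if and
only if avoiding it leaves finitely many points. -/
theorem InfiniteMinimal.finite_avoiding [DiscreteTopology A] (hX : InfiniteMinimal X)
    {c : PatternCode k m} (hc : ∃ x ∈ X.carrier, Matches gen letter x c) :
    (avoiding gen letter X c).carrier.Finite := by
  obtain ⟨x, hx, hxc⟩ := hc
  -- The inclusion is proper since `x`, translated by `1`, matches `c`.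
  refine hX.2 _ ⟨fun _ h => h.1, fun hsub => (hsub hx).2 1 ?_⟩
  simpa using hxc

end Correctness

/-! ### The certificates can be checked by a primitive recursive function -/

section Primrec

variable {k m : ℕ}

theorem primrec_lookup :
    Primrec₂ fun (l : List (Fin m)) (w : List (Fin k)) => l[encode w]? :=
  Primrec.list_getElem?.comp Primrec.fst (Primrec.encode.comp Primrec.snd)

theorem primrecRel_listMatches :
    PrimrecRel (ListMatches : List (Fin m) → PatternCode k m → Prop) := by
  have h : PrimrecRel fun (e : List (Fin k) × Fin m) (l : List (Fin m)) =>
      l[encode e.1]? = some e.2 :=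
    Primrec.eq.comp (primrec_lookup.comp Primrec.snd (Primrec.fst.comp Primrec.fst))
      (Primrec.option_some.comp (Primrec.snd.comp Primrec.fst))
  exact h.forall_mem_list.comp Primrec.snd Primrec.fst

theorem primrec_successors : Primrec (successors : List (List (Fin k)) → _) :=
  Primrec.list_flatMap Primrec.id
    (Primrec.list_map (Primrec.const _)
      (Primrec.list_cons.comp Primrec.snd (Primrec.snd.comp Primrec.fst)).to₂).to₂

theorem primrec_wordsBelow : Primrec (wordsBelow k) :=
  Primrec.list_flatMap Primrec.list_range
    (Primrec.optionToList.comp (Primrec.decode.comp Primrec.snd)).to₂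

theorem primrec_allLists : Primrec (allLists m) := by
  refine (Primrec.nat_rec₁ (f := fun _ L => L.flatMap fun l => (List.finRange m).map fun a => a :: l)
    [[]] ?_).of_eq fun N => ?_
  · exact (Primrec.list_flatMap Primrec.snd
      (Primrec.list_map (Primrec.const _)
        (Primrec.list_cons.comp Primrec.snd (Primrec.snd.comp Primrec.fst)).to₂).to₂).to₂
  · induction N with
    | zero => rfl
    | succ N ih => simp only [allLists, ← ih]

theorem primrec_translate : Primrec₂ (translate : PatternCode k m → _ → _) :=
  Primrec.list_map Primrec.fst
    ((Primrec.list_append.comp (Primrec.snd.comp Primrec.fst) (Primrec.fst.comp Primrec.snd)).pair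
      (Primrec.snd.comp Primrec.snd)).to₂

theorem primrecPred_refuted : PrimrecPred fun p :
    List (Fin m) × List (Fin m) × List (PatternCode k m) × List (List (Fin k)) =>
      Refuted p.2.2.1 p.2.2.2 p.1 p.2.1 := by
  have hxy : Primrec fun p :
      List (Fin m) × List (Fin m) × List (PatternCode k m) × List (List (Fin k)) =>
        (p.1, p.2.1) := Primrec.fst.pair (Primrec.fst.comp Primrec.snd)
  have hΦ : Primrec fun p :
      List (Fin m) × List (Fin m) × List (PatternCode k m) × List (List (Fin k)) => p.2.2.1 :=
    Primrec.fst.comp (Primrec.snd.comp Primrec.snd)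
  have hD : Primrec fun p :
      List (Fin m) × List (Fin m) × List (PatternCode k m) × List (List (Fin k)) => p.2.2.2 :=
    Primrec.snd.comp (Primrec.snd.comp Primrec.snd)
  have h1 : PrimrecRel fun (c : PatternCode k m) (q : List (Fin m) × List (Fin m)) =>
      ListMatches q.1 c ∨ ListMatches q.2 c :=
    (primrecRel_listMatches.comp (Primrec.fst.comp Primrec.snd) Primrec.fst).or
      (primrecRel_listMatches.comp (Primrec.snd.comp Primrec.snd) Primrec.fst)
  have h2 : PrimrecRel fun (d : List (Fin k)) (q : List (Fin m) × List (Fin m)) =>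
      q.1[encode d]? = q.2[encode d]? :=
    Primrec.eq.comp (primrec_lookup.comp (Primrec.fst.comp Primrec.snd) Primrec.fst)
      (primrec_lookup.comp (Primrec.snd.comp Primrec.snd) Primrec.fst)
  have h2' : PrimrecRel fun (d : List (Fin k)) (q : List (Fin m) × List (Fin m)) =>
      q.1[encode d]? ≠ q.2[encode d]? := PrimrecPred.not h2
  have h3 : PrimrecRel fun (d : List (Fin k)) (q : List (Fin m) × List (Fin m)) =>
      encode d < q.1.length ∧ q.1[encode d]? = q.2[encode d]? :=
    PrimrecPred.and (Primrec.nat_lt.comp (Primrec.encode.comp Primrec.fst)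
      (Primrec.list_length.comp (Primrec.fst.comp Primrec.snd))) h2
  exact (h1.exists_mem_list.comp hΦ hxy).or ((h2'.exists_mem_list.comp hD hxy).or
    (h3.forall_mem_list.comp (primrec_successors.comp hD) hxy))

theorem primrecPred_determinedCert : PrimrecPred fun p :
    (PatternCode k m × List (PatternCode k m)) × List (List (Fin k)) × ℕ =>
      DeterminedCert p.1.1 p.1.2 p.2.1 p.2.2 := by
  have h1 : PrimrecRel fun (x : List (Fin m))
      (q : List (Fin m) × List (PatternCode k m) × List (List (Fin k))) =>
        Refuted q.2.1 q.2.2 x q.1 := primrecPred_refuted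
  have h2 : PrimrecRel fun (y : List (Fin m))
      (q : List (List (Fin m)) × List (PatternCode k m) × List (List (Fin k))) =>
        ∀ x ∈ q.1, Refuted q.2.1 q.2.2 x y :=
    h1.forall_mem_list.comp (Primrec.fst.comp Primrec.snd)
      (Primrec.fst.pair (Primrec.snd.comp Primrec.snd))
  have hN : Primrec fun p :
      (PatternCode k m × List (PatternCode k m)) × List (List (Fin k)) × ℕ => allLists m p.2.2 :=
    primrec_allLists.comp (Primrec.snd.comp Primrec.snd)
  have hΦ : Primrec fun p :
      (PatternCode k m × List (PatternCode k m)) × List (List (Fin k)) × ℕ =>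
        p.1.2 ++ (wordsBelow k p.2.2).map (translate p.1.1) :=
    Primrec.list_append.comp (Primrec.snd.comp Primrec.fst)
      (Primrec.list_map (primrec_wordsBelow.comp (Primrec.snd.comp Primrec.snd))
        (primrec_translate.comp (Primrec.fst.comp (Primrec.fst.comp Primrec.fst))
          Primrec.snd).to₂)
  refine (h2.forall_mem_list.comp hN
    (hN.pair (hΦ.pair (Primrec.fst.comp Primrec.snd)))).of_eq fun p => ?_
  exact ⟨fun h x hx y hy => h y hy x hx, fun h y hy x hx => h x hx y hy⟩

theorem primrecRel_mem {α : Type*} [Primcodable α] :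
    PrimrecRel fun (a : α) (l : List α) => a ∈ l := by
  have h : PrimrecRel fun a b : α => a = b := Primrec.eq
  exact (h.exists_mem_list.comp Primrec.snd Primrec.fst).of_eq fun p => by simp

theorem primrecRel_excludedCert :
    PrimrecRel (ExcludedCert : PatternCode k m → List (PatternCode k m) → Prop) := by
  have h1 : PrimrecRel fun (e' : List (Fin k) × Fin m)
      (q : (List (Fin k) × Fin m) × List (PatternCode k m)) => [q.1, e'] ∈ q.2 :=
    primrecRel_mem.comp (Primrec.list_cons.comp (Primrec.fst.comp Primrec.snd)
      (Primrec.list_cons.comp Primrec.fst (Primrec.const []))) (Primrec.snd.comp Primrec.snd)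
  have h2 : PrimrecRel fun (e : List (Fin k) × Fin m)
      (q : PatternCode k m × List (PatternCode k m)) => ∃ e' ∈ q.1, [e, e'] ∈ q.2 :=
    h1.exists_mem_list.comp (Primrec.fst.comp Primrec.snd)
      (Primrec.fst.pair (Primrec.snd.comp Primrec.snd))
  exact (primrecRel_mem.comp Primrec.fst Primrec.snd).or
    (h2.exists_mem_list.comp Primrec.fst Primrec.id)

/-- The codes that occur in a list of pairs of optional codes. -/
def listed {β : Type*} (h : List (Option β × Option β)) : List β :=
  h.flatMap fun p => p.1.toList ++ p.2.toList

theorem primrec_listed {β : Type*} [Primcodable β] : Primrec (listed : List (Option β × _) → _) :=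
  Primrec.list_flatMap Primrec.id
    (Primrec.list_append.comp (Primrec.optionToList.comp (Primrec.fst.comp Primrec.snd))
      (Primrec.optionToList.comp (Primrec.snd.comp Primrec.snd))).to₂

/-- The set of words that is tested for separating points at stage `n`. -/
def testWords (k n : ℕ) : List (List (Fin k)) :=
  [] :: (decode n.unpair.2 : Option (List (List (Fin k)))).getD []

theorem primrec_testWords : Primrec (testWords k) :=
  Primrec.list_cons.comp (Primrec.const [])
    (Primrec.option_getD.comp
      (Primrec.decode.comp (Primrec.snd.comp Primrec.unpair)) (Primrec.const []))

open Classical in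
/-- The verdict on `c` that the certificates give after the codes in `h` have been listed. -/
noncomputable def verdict (c : PatternCode k m)
    (h : List (Option (PatternCode k m) × Option (PatternCode k m))) : Option Bool :=
  if ExcludedCert c (listed h) then some false
  else if DeterminedCert c (listed h) (testWords k h.length) h.length then some true
  else none

theorem primrec_verdict : Primrec₂ (verdict : PatternCode k m → _ → _) := by
  classical
  have hl : Primrec fun p : PatternCode k m × List (Option (PatternCode k m) × _) =>
    listed p.2 := primrec_listed.comp Primrec.snd
  have hn : Primrec fun p : PatternCode k m ×
      List (Option (PatternCode k m) × Option (PatternCode k m)) => p.2.length :=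
    Primrec.list_length.comp Primrec.snd
  exact Primrec.ite (primrecRel_excludedCert.comp Primrec.fst hl) (Primrec.const _)
    (Primrec.ite (primrecPred_determinedCert.comp
      ((Primrec.fst.pair hl).pair ((primrec_testWords.comp hn).pair hn)))
      (Primrec.const _) (Primrec.const _))

end Primrec

/-! ### The word problem -/

section WordProblem

variable {G : Type*} [Group G] {k m : ℕ} {gen : Fin k → G}

/-- Two words are equal in `G` if and only if an inverse of the first times the second is trivial.
Inverse words are computed from a finite table of words for the inverses of the generators. -/
theorem computable_wordEval_eq (hgen : IsGenerating gen) (hwp : DecidableWordProblem gen) :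
    ∃ q : List (Fin k) × List (Fin k) → Bool, Computable q ∧
      ∀ p, q p = true ↔ wordEval gen p.1 = wordEval gen p.2 := by
  obtain ⟨hdec, hcomp⟩ := hwp
  choose inv hinv using fun s => hgen (gen s)⁻¹
  have heval : ∀ w : List (Fin k), wordEval gen (w.reverse.flatMap inv) = (wordEval gen w)⁻¹ := by
    intro w
    induction w with
    | nil => simp
    | cons s w ih => simp [List.flatMap_append, ih, hinv]
  refine ⟨fun p => decide (wordEval gen (p.1.reverse.flatMap inv ++ p.2) = 1), ?_, fun p => ?_⟩
  · exact hcomp.comp (Primrec.list_append.comp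
      (Primrec.list_flatMap (Primrec.list_reverse.comp Primrec.fst)
        ((Primrec.dom_finite inv).comp Primrec.snd).to₂) Primrec.snd).to_comp
  · rw [decide_eq_true_iff, wordEval_append, heval, inv_mul_eq_one]

/-- The two-element codes that give different letters to the same element can be listed. -/
theorem exists_inconsistent_listing (hgen : IsGenerating gen) (hwp : DecidableWordProblem gen) :
    ∃ q : ℕ → Option (PatternCode k m), Computable q ∧ ∀ c, (∃ n, q n = some c) ↔
      ∃ e e', c = [e, e'] ∧ wordEval gen e.1 = wordEval gen e'.1 ∧ e.2 ≠ e'.2 := by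
  obtain ⟨r, hr, hr'⟩ := computable_wordEval_eq hgen hwp
  let t : (List (Fin k) × Fin m) × (List (Fin k) × Fin m) → Option (PatternCode k m) :=
    fun p => bif r (p.1.1, p.2.1) then (bif decide (p.1.2 = p.2.2) then none else some [p.1, p.2])
      else none
  have ht : Computable t := by
    have h1 : Primrec fun p : (List (Fin k) × Fin m) × (List (Fin k) × Fin m) =>
        (p.1.1, p.2.1) :=
      (Primrec.fst.comp Primrec.fst).pair (Primrec.fst.comp Primrec.snd)
    have h2 : Primrec fun p : (List (Fin k) × Fin m) × (List (Fin k) × Fin m) =>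
        decide (p.1.2 = p.2.2) :=
      (Primrec.dom_finite fun p : Fin m × Fin m => decide (p.1 = p.2)).comp
        ((Primrec.snd.comp Primrec.fst).pair (Primrec.snd.comp Primrec.snd))
    have h3 : Primrec fun p : (List (Fin k) × Fin m) × (List (Fin k) × Fin m) => [p.1, p.2] :=
      Primrec.list_cons.comp Primrec.fst (Primrec.list_cons.comp Primrec.snd (Primrec.const []))
    exact Computable.cond (hr.comp h1.to_comp)
      (Primrec.cond h2 (Primrec.const none) (Primrec.option_some.comp h3)).to_comp
      (Computable.const none)
  have htspec : ∀ p c, t p = some c ↔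
      c = [p.1, p.2] ∧ wordEval gen p.1.1 = wordEval gen p.2.1 ∧ p.1.2 ≠ p.2.2 := by
    intro p c
    rw [← hr' (p.1.1, p.2.1), eq_comm (a := c)]
    by_cases h : p.1.2 = p.2.2 <;> cases hb : r (p.1.1, p.2.1) <;> simp [t, h, hb]
  refine ⟨fun n => (decode n).bind t,
    Computable.option_bind Computable.decode (ht.comp Computable.snd).to₂, fun c => ?_⟩
  constructor
  · rintro ⟨n, hn⟩
    obtain ⟨p, -, hp⟩ := Option.bind_eq_some_iff.1 hn
    exact ⟨p.1, p.2, (htspec p c).1 hp⟩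
  · rintro ⟨e, e', h⟩
    exact ⟨encode (e, e'), by simpa using (htspec (e, e') c).2 h⟩

end WordProblem

/-! ### Exhausting sequences from enumerations, and the main theorem -/

section Main

variable {G : Type*} [Group G] {A : Type*} [TopologicalSpace A] {k m : ℕ} {gen : Fin k → G}
  {letter : Fin m ≃ A} {X : MulSubshift A G}

theorem exhausts_of_listings {f q : ℕ → Option (PatternCode k m)}
    (hf : ∀ c, c ∈ codes gen letter (language X.carrier)ᶜ ↔ ∃ n, f n = some c)
    (hq : ∀ c, (∃ n, q n = some c) ↔
      ∃ e e', c = [e, e'] ∧ wordEval gen e.1 = wordEval gen e'.1 ∧ e.2 ≠ e'.2) :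
    Exhausts gen letter X fun n => listed ((List.range n).map fun i => (f i, q i)) := by
  have hmem : ∀ n c, c ∈ listed ((List.range n).map fun i => (f i, q i)) ↔
      ∃ i < n, f i = some c ∨ q i = some c := by
    simp [listed]
  refine ⟨fun h c hc => ?_, fun n c hc x hx hxc => ?_, fun c hc => ?_, fun e e' h h' => ?_⟩
  · obtain ⟨i, hi, hc⟩ := (hmem _ _).1 hc
    exact (hmem _ _).2 ⟨i, hi.trans_le h, hc⟩
  · obtain ⟨i, -, hc | hc⟩ := (hmem _ _).1 hc
    · exact not_matches_of_mem_codes ((hf c).2 ⟨i, hc⟩) hx hxc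
    · obtain ⟨e, e', rfl, h, h'⟩ := (hq c).1 ⟨i, hc⟩
      have h1 := hxc e (by simp)
      rw [h, hxc e' (by simp)] at h1
      exact h' (letter.injective h1).symm
  · obtain ⟨i, hi⟩ := (hf c).1 hc
    exact ⟨i + 1, (hmem _ _).2 ⟨i, Nat.lt_succ_self i, Or.inl hi⟩⟩
  · obtain ⟨i, hi⟩ := (hq [e, e']).2 ⟨e, e', rfl, h, h'⟩
    exact ⟨i + 1, (hmem _ _).2 ⟨i, Nat.lt_succ_self i, Or.inr hi⟩⟩

end Main

end GShift

theorem mainTheorem9 {G : Type*} [Group G] {A : Type*} [TopologicalSpace A] [DiscreteTopology A]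
    {k m : ℕ} (gen : Fin k → G) (hgen : GShift.IsGenerating gen)
    (hwp : GShift.DecidableWordProblem gen) (letter : Fin m ≃ A)
    (X : SymbolicDynamics.FullShift.MulSubshift A G) (hX : GShift.InfiniteMinimal X) :
    GShift.StrongComputableType gen letter X := by
  classical
  rintro O ⟨f, hfO, hf⟩
  obtain ⟨x₀, -⟩ := hX.1.nonempty
  -- A letter is needed to extend consistent codes to configurations and to pad assignments.
  have : Nonempty A := ⟨x₀ 1⟩
  obtain ⟨q, hqc, hq⟩ := GShift.exists_inconsistent_listing (m := m) hgen hwp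
  have hΛ := GShift.exhausts_of_listings hf hq
  refine ComputableIn.of_history (hfO.pair hqc.computableIn) GShift.primrec_verdict.to_comp
    (fun c n b hb => ?_) fun c => ?_
  · rw [GShift.verdict] at hb
    split_ifs at hb with h1 h2
    · rw [← Option.some.inj hb, decide_eq_false_iff_not, GShift.mem_codes_language]
      rintro ⟨x, hx, hxc⟩
      exact h1.not_matches (hΛ.not_matches n) x hx hxc
    · rw [← Option.some.inj hb, decide_eq_true_iff, GShift.mem_codes_language]
      exact h2.exists_matches hgen hX.1 (hΛ.not_matches n) (by simp [GShift.testWords])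
  · suffices ∃ n, GShift.ExcludedCert c (GShift.listed ((List.range n).map fun i => (f i, q i))) ∨
        GShift.DeterminedCert c (GShift.listed ((List.range n).map fun i => (f i, q i)))
          (GShift.testWords k n) n by
      obtain ⟨n, hn⟩ := this
      refine ⟨n, ?_⟩
      rw [GShift.verdict]
      split_ifs with h1 h2
      · rfl
      · rfl
      · simp_all
    by_cases hc : c ∈ GShift.codes gen letter (GShift.language X.carrier)
    · obtain ⟨D, N, hN⟩ := hΛ.determinedCert hgen
        (hX.finite_avoiding (GShift.mem_codes_language.1 hc))
      -- This stage is at least `N`, and its second component makes `testWords` produce exactly `[]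
      -- :: D`.
      refine ⟨Nat.pair N (Encodable.encode D), Or.inr ?_⟩
      simpa [GShift.testWords] using hN _ (Nat.left_le_pair N (Encodable.encode D))
    · exact (hΛ.excludedCert hc).imp fun n hn => Or.inl hn
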